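/- For a finite simple graph $G$ of order $n$, let $P(G,x)$ be its chromatic polynomial, i.e. the polynomial in the real variable $x$ such that $P(G,k)$ is the number of proper $k$-colorings of $G$ for every positive integer $k$. Put $$\epsilon(G,x)=\frac{P'(G,x)}{P(G,x)},\qquad \epsilon(G)=\frac{\sum_{i=1}^n (n-i)a_i}{\sum_{i=1}^n a_i},\quad\text{where } P(G,x)=\sum_{i=1}^n(-1)^{n-i}a_i x^i .$$ Let $K_n$ be the complete graph of order $n$. Then for every finite simple graph $G$ of order $n$ that is not complete, $$\epsilon(G,x)<\epsilon(K_n,x)\quad\text{for all real } x<0,$$ and in particular (from the case $x=-1$) $\epsilon(G)<\epsilon(K_n)$. -/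

import Mathlib

open Polynomial

namespace ChromaticPoly

/-- For every finite graph there is a polynomial that counts the proper `k`-colorings. -/
theorem exists_polynomial {V : Type*} [Finite V] (G : SimpleGraph V) :
    ∃ p : ℝ[X], ∀ k : ℕ, 0 < k → p.eval (k : ℝ) = Nat.card (G.Coloring (Fin k)) := by
  classical
  have := Fintype.ofFinite V
  -- inclusion-exclusion over the sets of edges that are monochromatic
  let c : Finset (Sym2 V) → ℕ := fun S =>
    Nat.card (SimpleGraph.fromEdgeSet (S : Set (Sym2 V))).ConnectedComponent
  refine ⟨∑ S ∈ G.edgeFinset.powerset, (-1) ^ S.card * X ^ c S, fun k _ => ?_⟩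
  let mono : (V → Fin k) → Sym2 V → Prop := fun f e => ∀ u ∈ e, ∀ v ∈ e, f u = f v
  have hprop : Nat.card (G.Coloring (Fin k)) =
      Nat.card {f : V → Fin k // ∀ e ∈ G.edgeFinset, ¬ mono f e} := by
    refine Nat.card_congr
      { toFun := fun C => ⟨C, ?_⟩
        invFun := fun f => SimpleGraph.Coloring.mk f.1 ?_
        left_inv := fun C => by ext; rfl
        right_inv := fun f => rfl }
    · intro e
      induction e with | _ u v =>
      intro he hm
      rw [SimpleGraph.mem_edgeFinset, SimpleGraph.mem_edgeSet] at he
      exact C.valid he (hm u (by simp) v (by simp))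
    · intro u v huv h
      refine f.2 s(u, v) (by simpa using huv) ?_
      intro a ha b hb
      rw [Sym2.mem_iff] at ha hb
      rcases ha with rfl | rfl <;> rcases hb with rfl | rfl <;> simp [h]
  have hmono : ∀ S ∈ G.edgeFinset.powerset,
      Nat.card {f : V → Fin k // ∀ e ∈ S, mono f e} = k ^ c S := by
    intro S _
    have h1 : Nat.card ((SimpleGraph.fromEdgeSet (S : Set (Sym2 V))).ConnectedComponent → Fin k)
        = k ^ c S := by
      rw [Nat.card_fun]; simp [c]
    rw [← h1]
    refine Nat.card_congr
      { toFun := fun f => SimpleGraph.ConnectedComponent.lift f.1 ?_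
        invFun := fun g => ⟨fun v => g (SimpleGraph.connectedComponentMk _ v), ?_⟩
        left_inv := fun f => rfl
        right_inv := fun g => ?_ }
    · intro u v p _
      induction p with
      | nil => rfl
      | cons h _ ih =>
        rename_i hp
        rw [SimpleGraph.fromEdgeSet_adj] at h
        exact (f.2 _ h.1 _ (by simp) _ (by simp)).trans (ih (by simp_all))
    · intro e
      induction e with | _ a b =>
      intro he u hu v hv
      by_cases huv : u = v
      · rw [huv]
      have : s(a, b) = s(u, v) := (Sym2.mem_and_mem_iff huv).1 ⟨hu, hv⟩
      rw [this] at he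
      have hadj : (SimpleGraph.fromEdgeSet (S : Set (Sym2 V))).Adj u v := by
        rw [SimpleGraph.fromEdgeSet_adj]; exact ⟨he, huv⟩
      exact congrArg g (SimpleGraph.ConnectedComponent.sound hadj.reachable)
    · funext q
      induction q using SimpleGraph.ConnectedComponent.ind
      rfl
  rw [hprop, Nat.card_eq_fintype_card, Fintype.card_subtype, Finset.card_filter]
  push_cast
  have hind : ∀ f : V → Fin k, (if ∀ e ∈ G.edgeFinset, ¬ mono f e then (1 : ℝ) else 0) =
      ∑ S ∈ G.edgeFinset.powerset, (-1) ^ S.card * (if ∀ e ∈ S, mono f e then (1 : ℝ) else 0) := by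
    intro f
    have h1 : (if ∀ e ∈ G.edgeFinset, ¬ mono f e then (1 : ℝ) else 0) =
        ∏ e ∈ G.edgeFinset, (1 - if mono f e then (1 : ℝ) else 0) := by
      have h2 := Finset.prod_boole (M₀ := ℝ) (s := G.edgeFinset) (p := fun e => ¬ mono f e)
      refine Eq.trans (by congr) (h2.symm.trans ?_)
      refine Finset.prod_congr rfl fun e _ => ?_
      by_cases h : mono f e <;> simp [h]
    rw [h1]
    simp only [sub_eq_add_neg]
    rw [Finset.prod_one_add]
    refine Finset.sum_congr rfl fun S _ => ?_
    rw [Finset.prod_neg, Finset.prod_boole]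
    congr
  simp only [hind]
  rw [Finset.sum_comm, eval_finsetSum]
  refine Finset.sum_congr rfl fun S hS => ?_
  rw [← Finset.mul_sum, ← Nat.cast_one, ← Nat.cast_zero]
  have := hmono S hS
  rw [Nat.card_eq_fintype_card, Fintype.card_subtype, Finset.card_filter] at this
  have h2 := congrArg (Nat.cast : ℕ → ℝ) this
  push_cast at h2 ⊢
  rw [h2]
  simp

end ChromaticPoly

/-- The chromatic polynomial `P(G, x)` of a finite simple graph: the polynomial whose value at
every positive integer `k` is the number of proper `k`-colorings of `G`. -/
noncomputable def chromaticPoly {V : Type*} [Finite V] (G : SimpleGraph V) : ℝ[X] :=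
  (ChromaticPoly.exists_polynomial G).choose

theorem chromaticPoly_eval {V : Type*} [Finite V] (G : SimpleGraph V) (k : ℕ) (hk : 0 < k) :
    (chromaticPoly G).eval (k : ℝ) = Nat.card (G.Coloring (Fin k)) :=
  (ChromaticPoly.exists_polynomial G).choose_spec k hk

/-- The chromatic polynomial is determined by its values at the positive integers. -/
theorem chromaticPoly_unique {V : Type*} [Finite V] (G : SimpleGraph V) (p : ℝ[X])
    (hp : ∀ k : ℕ, 0 < k → p.eval (k : ℝ) = Nat.card (G.Coloring (Fin k))) :
    p = chromaticPoly G := by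
  refine Polynomial.eq_of_infinite_eval_eq _ _
    (Set.infinite_of_injective_forall_mem (f := fun k : ℕ => ((k + 1 : ℕ) : ℝ)) ?_ ?_)
  · intro a b h
    simpa using h
  · intro k
    exact (hp _ k.succ_pos).trans (chromaticPoly_eval G _ k.succ_pos).symm

/-- `ε(G, x) = P'(G, x) / P(G, x)`. -/
noncomputable def chromaticEps {V : Type*} [Finite V] (G : SimpleGraph V) (x : ℝ) : ℝ :=
  (derivative (chromaticPoly G)).eval x / (chromaticPoly G).eval x

/-- The number `a_i(G)` in `P(G, x) = ∑ i, (-1) ^ (n - i) * a_i(G) * x ^ i`, for `i ≤ n`, where `n`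
is the order of `G`. -/
noncomputable def chromaticCoeff {V : Type*} [Finite V] (G : SimpleGraph V) (i : ℕ) : ℝ :=
  (-1) ^ (Nat.card V - i) * (chromaticPoly G).coeff i

/-- `ε(G) = ∑ (n - i) a_i / ∑ a_i`, both sums over `1 ≤ i ≤ n`, with `n` the order of `G`. -/
noncomputable def meanSize {V : Type*} [Finite V] (G : SimpleGraph V) : ℝ :=
  (∑ i ∈ Finset.Icc 1 (Nat.card V), ((Nat.card V : ℝ) - i) * chromaticCoeff G i) /
    ∑ i ∈ Finset.Icc 1 (Nat.card V), chromaticCoeff G i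

/-!
Up to signs, the chromatic polynomials of the induced subgraphs `G[S]` form an exponential family:
`p(S) = (-1) ^ #S * P(G[S], -y)` is the exponential of `y * U` with respect to the convolution of
set functions, where `U(S)` counts the pairs of a vertex `v` and an acyclic orientation of `G[S]`
whose only source is `v`. To see this, note that adding a color class convolves the signed numbers
of colorings with the signed indicator of independent sets, and that convolving `U` with that
indicator multiplies it by `-#S`: orient the edges from `T` to the independent set `S \ T` towards
`S \ T`; then each acyclic orientation of `G[S]` contributes an alternating sum over an interval of
sets `T`, which vanishes unless the orientation has no arc.

For `K_n` the logarithmic derivative of `p` is `1 / y + 1 / (y + 1) + ⋯ + 1 / (y + n - 1)`. In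
general it is at least this sum. In an acyclic orientation of `G[S]` whose only source is `v`, the
vertices other than `v` can be ordered so that the `i`-th of them reaches at most `i` vertices, and
cutting along the set reached by a vertex produces two orientations with unique sources. Summing
decreasing weights of the sizes of the reached sets therefore bounds `U` by the convolution of `U`
with a weighted `U`, and in the differential equation for the exponential the difference of both
sides is a nonnegative source term. A nonadjacent pair `{a, b}` has `U({a, b}) = 0`, while
`U({a}) * U({b}) > 0`, so it makes this source term positive.
-/

namespace ChromaticPoly

section SetConvolution

variable {V M R : Type*} [DecidableEq V]

theorem sum_powerset_sdiff_swap [AddCommMonoid M] (F : Finset V → Finset V → M) (S : Finset V) :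
    ∑ T ∈ S.powerset, F T (S \ T) = ∑ T ∈ S.powerset, F (S \ T) T := by
  refine Finset.sum_nbij' (S \ ·) (S \ ·) ?_ ?_ ?_ ?_ ?_ <;>
    simp +contextual

theorem sum_powerset_powerset_sdiff [AddCommMonoid M] (F : Finset V → Finset V → Finset V → M)
    (S : Finset V) :
    ∑ T ∈ S.powerset, ∑ A ∈ T.powerset, F A (T \ A) (S \ T) =
      ∑ A ∈ S.powerset, ∑ B ∈ (S \ A).powerset, F A B ((S \ A) \ B) := by
  rw [Finset.sum_sigma', Finset.sum_sigma']
  refine Finset.sum_nbij' (fun p => ⟨p.2, p.1 \ p.2⟩) (fun p => ⟨p.1 ∪ p.2, p.1⟩) ?_ ?_ ?_ ?_ ?_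
  · rintro ⟨T, A⟩ h
    simp only [Finset.mem_sigma, Finset.mem_powerset] at h ⊢
    exact ⟨h.2.trans h.1, Finset.sdiff_subset_sdiff h.1 subset_rfl⟩
  · rintro ⟨A, B⟩ h
    simp only [Finset.mem_sigma, Finset.mem_powerset, Finset.subset_sdiff] at h ⊢
    exact ⟨Finset.union_subset h.1 h.2.1, Finset.subset_union_left⟩
  · rintro ⟨T, A⟩ h
    simp only [Finset.mem_sigma, Finset.mem_powerset] at h
    simp [h.2]
  · rintro ⟨A, B⟩ h
    simp only [Finset.mem_sigma, Finset.mem_powerset, Finset.subset_sdiff] at h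
    simp [Finset.union_sdiff_cancel_left h.2.2.symm]
  · rintro ⟨T, A⟩ h
    simp only [Finset.mem_sigma, Finset.mem_powerset] at h
    simp [sdiff_sdiff_left, Finset.union_eq_right.2 h.2]

/-- The convolution of two set functions, which multiplies exponential generating functions over
labelled structures: a set is split into an ordered pair of complementary subsets. -/
def setConv [CommSemiring R] (f g : Finset V → R) (S : Finset V) : R :=
  ∑ T ∈ S.powerset, f T * g (S \ T)

section CommSemiring

variable [CommSemiring R]

theorem setConv_comm (f g : Finset V → R) : setConv f g = setConv g f := by
  funext S
  simp only [setConv, mul_comm (f _), sum_powerset_sdiff_swap (fun A B => g B * f A)]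

theorem setConv_assoc (f g h : Finset V → R) :
    setConv (setConv f g) h = setConv f (setConv g h) := by
  funext S
  simp only [setConv, Finset.sum_mul, Finset.mul_sum, mul_assoc]
  exact sum_powerset_powerset_sdiff (fun A B C => f A * (g B * h C)) S

theorem setConv_left_comm (f g h : Finset V → R) :
    setConv f (setConv g h) = setConv g (setConv f h) := by
  rw [← setConv_assoc, setConv_comm f g, setConv_assoc]

theorem setConv_const_mul_left (c : R) (f g : Finset V → R) (S : Finset V) :
    setConv (fun T => c * f T) g S = c * setConv f g S := by
  simp only [setConv, Finset.mul_sum, mul_assoc]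

theorem setConv_const_mul_right (c : R) (f g : Finset V → R) (S : Finset V) :
    setConv f (fun T => c * g T) S = c * setConv f g S := by
  simp only [setConv, Finset.mul_sum, mul_left_comm]

theorem setConv_sum_left {ι : Type*} (s : Finset ι) (f : ι → Finset V → R) (g : Finset V → R)
    (S : Finset V) : setConv (fun T => ∑ i ∈ s, f i T) g S = ∑ i ∈ s, setConv (f i) g S := by
  simp only [setConv, Finset.sum_mul]
  exact Finset.sum_comm

theorem card_mul_setConv (f g : Finset V → R) (S : Finset V) :
    S.card * setConv f g S =
      setConv (fun T => T.card * f T) g S + setConv f (fun T => T.card * g T) S := by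
  simp only [setConv, Finset.mul_sum, ← Finset.sum_add_distrib]
  refine Finset.sum_congr rfl fun T hT => ?_
  rw [← Finset.card_sdiff_add_card_eq_card (Finset.mem_powerset.1 hT)]
  push_cast
  ring

end CommSemiring

theorem sum_Icc_neg_one_pow_card [Ring R] (X Y : Finset V) :
    ∑ T ∈ Finset.Icc X Y, (-1 : R) ^ T.card = if X = Y then (-1) ^ X.card else 0 := by
  by_cases hXY : X ⊆ Y
  · have hinj : Set.InjOn (X ∪ ·) ((Y \ X).powerset : Set (Finset V)) := by
      intro A hA B hB (hAB : X ∪ A = X ∪ B)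
      simp only [Finset.coe_powerset, Set.mem_preimage, Set.mem_powerset_iff, Finset.coe_subset,
        Finset.subset_sdiff] at hA hB
      rw [← Finset.union_sdiff_cancel_left hA.2.symm, hAB,
        Finset.union_sdiff_cancel_left hB.2.symm]
    have hsum : ∑ A ∈ (Y \ X).powerset, (-1 : R) ^ A.card = if X = Y then 1 else 0 := by
      have hiff : Y \ X = ∅ ↔ X = Y := by
        rw [Finset.sdiff_eq_empty_iff_subset]
        exact ⟨hXY.antisymm, fun h => h.ge⟩
      simpa [hiff] using congrArg (Int.cast : ℤ → R)
        (Finset.sum_powerset_neg_one_pow_card (x := Y \ X))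
    calc ∑ T ∈ Finset.Icc X Y, (-1 : R) ^ T.card
        = ∑ A ∈ (Y \ X).powerset, (-1) ^ (X ∪ A).card := by
          rw [Finset.Icc_eq_image_powerset hXY, Finset.sum_image hinj]
      _ = ∑ A ∈ (Y \ X).powerset, (-1) ^ X.card * (-1) ^ A.card := by
          refine Finset.sum_congr rfl fun A hA => ?_
          rw [Finset.mem_powerset, Finset.subset_sdiff] at hA
          rw [Finset.card_union_of_disjoint hA.2.symm, pow_add]
      _ = if X = Y then (-1) ^ X.card else 0 := by
          rw [← Finset.mul_sum, hsum, mul_ite, mul_one, mul_zero]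
  · rw [Finset.Icc_eq_empty (by simpa using hXY), if_neg (fun h => hXY h.subset), Finset.sum_empty]

end SetConvolution

section SetExponential

variable {V : Type*} [DecidableEq V]

/-- The polynomials `P S` form the set exponential `exp (X * U)` with respect to subset
convolution. This is encoded by the differential equation that counting points imposes, which
avoids dividing by factorials. -/
structure IsSetExp (U : Finset V → ℝ) (P : Finset V → ℝ[X]) : Prop where
  apply_empty : P ∅ = 1
  card_mul : ∀ S, (S.card : ℝ[X]) * P S = X * setConv (fun T => C (U T)) P S

namespace IsSetExp

variable {U : Finset V → ℝ} {P : Finset V → ℝ[X]} {S : Finset V} {y : ℝ}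

theorem weight_empty (h : IsSetExp U P) : U ∅ = 0 := by
  simpa [setConv, h.apply_empty] using h.card_mul ∅

theorem natDegree_le (h : IsSetExp U P) (S : Finset V) : (P S).natDegree ≤ S.card := by
  induction S using Finset.strongInduction with | H S ih =>
  rcases S.eq_empty_or_nonempty with rfl | hS
  · simp [h.apply_empty]
  have hterm : ∀ T ∈ S.powerset, (C (U T) * P (S \ T)).natDegree ≤ S.card - 1 := by
    intro T hT
    rcases T.eq_empty_or_nonempty with rfl | hT0
    · simp [h.weight_empty]
    have hss := Finset.sdiff_ssubset (Finset.mem_powerset.1 hT) hT0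
    exact (natDegree_C_mul_le _ _).trans <|
      (ih _ hss).trans (Nat.le_sub_one_of_lt (Finset.card_lt_card hss))
  calc (P S).natDegree = ((S.card : ℝ[X]) * P S).natDegree := by
        rw [← C_eq_natCast, natDegree_C_mul (by simpa using hS.ne_empty)]
    _ ≤ 1 + (S.card - 1) := by
        rw [h.card_mul, setConv]
        exact natDegree_mul_le_of_le natDegree_X_le (natDegree_sum_le_of_forall_le _ _ hterm)
    _ = S.card := Nat.add_sub_cancel' hS.card_pos

theorem coeff_zero (h : IsSetExp U P) (hS : S.Nonempty) : (P S).coeff 0 = 0 := by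
  simpa [mul_coeff_zero, hS.ne_empty] using congrArg (coeff · 0) (h.card_mul S)

theorem card_mul_eval (h : IsSetExp U P) (y : ℝ) (S : Finset V) :
    S.card * (P S).eval y = y * setConv U (fun T => (P T).eval y) S := by
  simpa [setConv, eval_finsetSum] using congrArg (eval y) (h.card_mul S)

theorem card_mul_eval_derivative (h : IsSetExp U P) (y : ℝ) (S : Finset V) :
    S.card * (derivative (P S)).eval y =
      setConv U (fun T => (P T).eval y) S +
        y * setConv U (fun T => (derivative (P T)).eval y) S := by
  simpa [setConv, eval_finsetSum] using congrArg (fun p => eval y (derivative p)) (h.card_mul S)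

theorem eval_pos (h : IsSetExp U P) (hU : ∀ T, 0 ≤ U T) (hsingleton : ∀ v, 0 < U {v}) (hy : 0 < y)
    (S : Finset V) : 0 < (P S).eval y := by
  induction S using Finset.strongInduction with | H S ih =>
  rcases S.eq_empty_or_nonempty with rfl | ⟨v, hv⟩
  · simp [h.apply_empty]
  have hterm : ∀ T ∈ S.powerset, 0 ≤ U T * (P (S \ T)).eval y := by
    intro T hT
    rcases T.eq_empty_or_nonempty with rfl | hT0
    · simp [h.weight_empty]
    · exact mul_nonneg (hU T) (ih _ (Finset.sdiff_ssubset (Finset.mem_powerset.1 hT) hT0)).le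
  have hmem : {v} ∈ S.powerset := by simpa using hv
  have hconv : 0 < setConv U (fun T => (P T).eval y) S :=
    Finset.sum_pos' hterm ⟨{v}, hmem, mul_pos (hsingleton v)
      (ih _ (Finset.sdiff_ssubset (Finset.mem_powerset.1 hmem) (Finset.singleton_nonempty v)))⟩
  refine pos_of_mul_pos_right ?_ (Nat.cast_nonneg S.card)
  rw [h.card_mul_eval]
  exact mul_pos hy hconv

end IsSetExp

/-- The sum `1 / y + 1 / (y + 1) + ⋯ + 1 / (y + n - 1)`, the logarithmic derivative at `y` of the
rising factorial. -/
noncomputable def harmonicShift (y : ℝ) (n : ℕ) : ℝ := ∑ i ∈ Finset.range n, 1 / (y + i)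

/-- The defect in the inequality that bounds `w 0 + ⋯ + w (t - 1)` by the sum of the weights
`w #(reach x)` over the nonroot points `x`, plus `w 0` for the root, totalled over the `U T` rooted
structures on a set `T` of size `t`. The structures in which a point reaches the set `R` are
counted by `U R * U (T \ R)`. -/
def reachGap (U : Finset V → ℝ) (w : ℕ → ℝ) (T : Finset V) : ℝ :=
  w 0 * U T + setConv U (fun R => w R.card * U R) T - U T * ∑ k ∈ Finset.range T.card, w k

theorem harmonicShift_add (y : ℝ) (m t : ℕ) :
    harmonicShift y (m + t) = harmonicShift y m + ∑ k ∈ Finset.range t, (y + m + k)⁻¹ := by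
  simp [harmonicShift, Finset.sum_range_add, add_assoc]

theorem antitone_inv_add {c : ℝ} (hc : 0 < c) : Antitone fun k : ℕ => (c + k)⁻¹ := by
  intro i j hij
  exact inv_anti₀ (by positivity) (by gcongr)

/-- The properties of the numbers of rooted structures that make the harmonic bound of
`IsSetExp.harmonicShift_mul_eval_le` work. -/
structure IsReachWeight (U : Finset V → ℝ) : Prop where
  nonneg : ∀ T, 0 ≤ U T
  singleton_pos : ∀ v, 0 < U {v}
  reachGap_nonneg : ∀ {w : ℕ → ℝ}, Antitone w → (∀ k, 0 ≤ w k) → ∀ T, 0 ≤ reachGap U w T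

theorem IsReachWeight.reachGap_pair_pos {U : Finset V → ℝ} {w : ℕ → ℝ} {a b : V}
    (hU : IsReachWeight U) (hw : ∀ k, 0 < w k) (hab : a ≠ b) (hUab : U {a, b} = 0) :
    0 < reachGap U w {a, b} := by
  have hsdiff : ({a, b} : Finset V) \ {a} = {b} := by
    rw [Finset.insert_sdiff_of_mem _ (Finset.mem_singleton_self a),
      Finset.sdiff_eq_self_of_disjoint (by simpa using hab.symm)]
  rw [reachGap, hUab, mul_zero, zero_mul, zero_add, sub_zero]
  refine Finset.sum_pos' (fun R _ => mul_nonneg (hU.nonneg R) (mul_nonneg (hw _).le (hU.nonneg _)))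
    ⟨{a}, by simp, mul_pos (hU.singleton_pos a) (mul_pos (hw _) ?_)⟩
  rw [hsdiff]
  exact hU.singleton_pos b

namespace IsSetExp

variable {U : Finset V → ℝ} {P : Finset V → ℝ[X]} {S : Finset V} {y : ℝ}

theorem setConv_eval_eq_sum (h : IsSetExp U P) (hy : 0 < y) (S : Finset V) :
    setConv U (fun T => (P T).eval y) S =
      ∑ T ∈ S.powerset, y * (P (S \ T)).eval y *
        ((y + (S \ T).card)⁻¹ * U T +
          setConv U (fun R => (y + (S \ T).card + R.card)⁻¹ * U R) T) := by
  have hpairs : ∑ T ∈ S.powerset, y * (P (S \ T)).eval y *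
      setConv U (fun R => (y + (S \ T).card + R.card)⁻¹ * U R) T =
        ∑ A ∈ S.powerset, U A * ((y + (S \ A).card)⁻¹ * ((S \ A).card * (P (S \ A)).eval y)) := by
    simp only [setConv, Finset.mul_sum]
    rw [sum_powerset_powerset_sdiff (fun A B D =>
      y * (P D).eval y * (U A * ((y + D.card + B.card)⁻¹ * U B)))]
    refine Finset.sum_congr rfl fun A _ => ?_
    rw [h.card_mul_eval, setConv, Finset.mul_sum, Finset.mul_sum, Finset.mul_sum]
    refine Finset.sum_congr rfl fun B hB => ?_
    rw [← Finset.card_sdiff_add_card_eq_card (Finset.mem_powerset.1 hB)]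
    push_cast
    ring
  simp only [mul_add, Finset.sum_add_distrib]
  rw [hpairs, ← Finset.sum_add_distrib]
  refine Finset.sum_congr rfl fun T _ => ?_
  have hne : y + ((S \ T).card : ℝ) ≠ 0 := by positivity
  field_simp

/-- The excess `P' - H P` of the derivative over the harmonic bound solves the differential
equation of `P` with an extra source term, which is a positive combination of reach gaps. -/
theorem card_mul_excess (h : IsSetExp U P) (hy : 0 < y) (S : Finset V) :
    S.card * ((derivative (P S)).eval y - harmonicShift y S.card * (P S).eval y) =
      ∑ T ∈ S.powerset, y * (P (S \ T)).eval y *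
          reachGap U (fun k => (y + (S \ T).card + k)⁻¹) T +
        y * setConv U (fun T => (derivative (P T)).eval y -
          harmonicShift y T.card * (P T).eval y) S := by
  have hharm : ∀ T ∈ S.powerset, harmonicShift y S.card = harmonicShift y (S \ T).card +
      ∑ k ∈ Finset.range T.card, (y + (S \ T).card + k)⁻¹ := by
    intro T hT
    rw [← harmonicShift_add, Finset.card_sdiff_add_card_eq_card (Finset.mem_powerset.1 hT)]
  rw [mul_sub, h.card_mul_eval_derivative, h.setConv_eval_eq_sum hy, mul_left_comm,
    h.card_mul_eval]
  simp only [setConv, Finset.mul_sum, ← Finset.sum_add_distrib, ← Finset.sum_sub_distrib]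
  refine Finset.sum_congr rfl fun T hT => ?_
  rw [hharm T hT, reachGap, setConv]
  push_cast
  ring

theorem reachGap_term_nonneg (h : IsSetExp U P) (hU : IsReachWeight U) (hy : 0 < y)
    (S T : Finset V) :
    0 ≤ y * (P (S \ T)).eval y * reachGap U (fun k => (y + (S \ T).card + k)⁻¹) T :=
  mul_nonneg (mul_nonneg hy.le (h.eval_pos hU.nonneg hU.singleton_pos hy _).le)
    (hU.reachGap_nonneg (antitone_inv_add (by positivity)) (fun _ => by positivity) T)

theorem harmonicShift_mul_eval_le (h : IsSetExp U P) (hU : IsReachWeight U) (hy : 0 < y)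
    (S : Finset V) :
    harmonicShift y S.card * (P S).eval y ≤ (derivative (P S)).eval y := by
  induction S using Finset.strongInduction with | H S ih =>
  rcases S.eq_empty_or_nonempty with rfl | hS
  · simp [harmonicShift, h.apply_empty]
  have hterm : ∀ T ∈ S.powerset, 0 ≤ U T * ((derivative (P (S \ T))).eval y -
      harmonicShift y (S \ T).card * (P (S \ T)).eval y) := by
    intro T hT
    rcases T.eq_empty_or_nonempty with rfl | hT0
    · simp [h.weight_empty]
    · exact mul_nonneg (hU.nonneg T)
        (sub_nonneg.2 (ih _ (Finset.sdiff_ssubset (Finset.mem_powerset.1 hT) hT0)))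
  rw [← sub_nonneg]
  refine nonneg_of_mul_nonneg_right ?_ (Nat.cast_pos.2 hS.card_pos)
  rw [h.card_mul_excess hy]
  exact add_nonneg (Finset.sum_nonneg fun T _ => h.reachGap_term_nonneg hU hy S T)
    (mul_nonneg hy.le (Finset.sum_nonneg hterm))

theorem harmonicShift_mul_eval_lt (h : IsSetExp U P) (hU : IsReachWeight U) (hy : 0 < y)
    {a b : V} (ha : a ∈ S) (hb : b ∈ S) (hab : a ≠ b) (hUab : U {a, b} = 0) :
    harmonicShift y S.card * (P S).eval y < (derivative (P S)).eval y := by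
  have hexcess : 0 ≤ setConv U (fun T => (derivative (P T)).eval y -
      harmonicShift y T.card * (P T).eval y) S := Finset.sum_nonneg fun T _ =>
    mul_nonneg (hU.nonneg T) (sub_nonneg.2 (h.harmonicShift_mul_eval_le hU hy _))
  have hpair : 0 < ∑ T ∈ S.powerset, y * (P (S \ T)).eval y *
      reachGap U (fun k => (y + (S \ T).card + k)⁻¹) T := by
    refine Finset.sum_pos' (fun T _ => h.reachGap_term_nonneg hU hy S T) ⟨{a, b}, ?_, ?_⟩
    · simp [Finset.insert_subset_iff, ha, hb]
    · exact mul_pos (mul_pos hy (h.eval_pos hU.nonneg hU.singleton_pos hy _))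
        (hU.reachGap_pair_pos (fun _ => by positivity) hab hUab)
  rw [← sub_pos]
  refine pos_of_mul_pos_right ?_ (Nat.cast_nonneg S.card)
  rw [h.card_mul_excess hy]
  exact add_pos_of_pos_of_nonneg hpair (mul_nonneg hy.le hexcess)

end IsSetExp

end SetExponential

section Orientations

variable {V : Type*} {G : SimpleGraph V} {S T : Finset V} {O O' : V → V → Prop}

/-- `O` is an acyclic orientation of the subgraph of `G` induced by `S`, as a relation on all
vertices. Acyclicity is encoded by a rank function that increases along the arcs. -/
structure IsAcyclicOrientation (G : SimpleGraph V) (S : Finset V) (O : V → V → Prop) : Prop where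
  adj : ∀ {a b}, O a b → G.Adj a b
  left_mem : ∀ {a b}, O a b → a ∈ S
  right_mem : ∀ {a b}, O a b → b ∈ S
  total : ∀ {a b}, a ∈ S → b ∈ S → G.Adj a b → O a b ∨ O b a
  rank : ∃ f : V → ℕ, ∀ a b, O a b → f a < f b

/-- `O` is an acyclic orientation of the subgraph of `G` induced by `S` whose only source is the
vertex `v` of `S`. -/
structure IsRootedOrientation (G : SimpleGraph V) (v : V) (S : Finset V) (O : V → V → Prop) : Prop
    extends IsAcyclicOrientation G S O where
  root_mem : v ∈ S
  exists_arc : ∀ x ∈ S, x ≠ v → ∃ z, O z x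

/-- The restriction of a relation to a set of vertices. -/
def restrictRel (O : V → V → Prop) (R : Finset V) : V → V → Prop :=
  fun a b => O a b ∧ a ∈ R ∧ b ∈ R

namespace IsAcyclicOrientation

theorem restrict (h : IsAcyclicOrientation G S O) (hT : T ⊆ S) :
    IsAcyclicOrientation G T (restrictRel O T) where
  adj hab := h.adj hab.1
  left_mem hab := hab.2.1
  right_mem hab := hab.2.2
  total ha hb hab := (h.total (hT ha) (hT hb) hab).imp (⟨·, ha, hb⟩) (⟨·, hb, ha⟩)
  rank := h.rank.imp fun _ hf a b hab => hf a b hab.1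

variable [DecidableEq V] {R : Finset V}

theorem le_of_restrictRel_le (h : IsAcyclicOrientation G S O) (h' : IsAcyclicOrientation G S O')
    (hR : ∀ ⦃a b⦄, O a b → a ∈ R → b ∈ R) (hR' : ∀ ⦃a b⦄, O' a b → a ∈ R → b ∈ R)
    (hle : restrictRel O R ≤ restrictRel O' R)
    (hle_sdiff : restrictRel O (S \ R) ≤ restrictRel O' (S \ R)) : O ≤ O' := by
  intro a b hab
  have ha := h.left_mem hab
  have hb := h.right_mem hab
  by_cases haR : a ∈ R
  · exact (hle a b ⟨hab, haR, hR hab haR⟩).1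
  by_cases hbR : b ∈ R
  · exact (h'.total ha hb (h.adj hab)).resolve_right fun hba => haR (hR' hba hbR)
  · exact (hle_sdiff a b ⟨hab, Finset.mem_sdiff.2 ⟨ha, haR⟩, Finset.mem_sdiff.2 ⟨hb, hbR⟩⟩).1

theorem eq_of_restrictRel_eq (h : IsAcyclicOrientation G S O) (h' : IsAcyclicOrientation G S O')
    (hR : ∀ ⦃a b⦄, O a b → a ∈ R → b ∈ R) (hR' : ∀ ⦃a b⦄, O' a b → a ∈ R → b ∈ R)
    (heq : restrictRel O R = restrictRel O' R)
    (heq_sdiff : restrictRel O (S \ R) = restrictRel O' (S \ R)) : O = O' :=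
  (h.le_of_restrictRel_le h' hR hR' heq.le heq_sdiff.le).antisymm
    (h'.le_of_restrictRel_le h hR' hR heq.ge heq_sdiff.ge)

end IsAcyclicOrientation

theorem isAcyclicOrientation_bot : IsAcyclicOrientation G S ⊥ ↔ G.IsIndepSet (S : Set V) where
  mp h _ ha _ hb _ hab := (h.total ha hb hab).elim id id
  mpr h := ⟨False.elim, False.elim, False.elim, fun ha hb hab => (h ha hb hab.ne hab).elim,
    0, fun _ _ => False.elim⟩

theorem IsRootedOrientation.not_arc_root {v : V} (h : IsRootedOrientation G v S O) (z : V) :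
    ¬ O z v := by
  obtain ⟨f, hf⟩ := h.rank
  obtain ⟨m, hm, hmin⟩ := Finset.exists_min_image S f ⟨v, h.root_mem⟩
  have hsource : ∀ z, ¬ O z m := fun z hz => (hf z m hz).not_ge (hmin z (h.left_mem hz))
  obtain rfl : m = v := by
    by_contra hmv
    obtain ⟨z, hz⟩ := h.exists_arc m hm hmv
    exact hsource z hz
  exact hsource z

section ReachSet

variable [Fintype V]

open scoped Classical in
/-- The set of vertices that can be reached from `x`. -/
noncomputable def reachSet (O : V → V → Prop) (x : V) : Finset V :=
  {z | Relation.ReflTransGen O x z}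

theorem mem_reachSet {x z : V} : z ∈ reachSet O x ↔ Relation.ReflTransGen O x z := by
  simp [reachSet]

theorem self_mem_reachSet (O : V → V → Prop) (x : V) : x ∈ reachSet O x :=
  mem_reachSet.2 .refl

theorem mem_reachSet_of_arc {x a b : V} (hab : O a b) (ha : a ∈ reachSet O x) :
    b ∈ reachSet O x :=
  mem_reachSet.2 ((mem_reachSet.1 ha).tail hab)

theorem reachSet_subset {A : Finset V} (hA : ∀ ⦃a b⦄, O a b → a ∈ A → b ∈ A) {x : V} (hx : x ∈ A) :
    reachSet O x ⊆ A := by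
  intro z hz
  rw [mem_reachSet] at hz
  induction hz with
  | refl => exact hx
  | tail _ hab ih => exact hA hab ih

/-- Removing a vertex of least rank from a closed set `A` leaves a closed set, and such a vertex
reaches at most `#A` vertices. -/
theorem sum_range_le_sum_reachSet {f : V → ℕ} (hf : ∀ a b, O a b → f a < f b)
    {w : ℕ → ℝ} (hw : Antitone w) (A : Finset V) (hA : ∀ ⦃a b⦄, O a b → a ∈ A → b ∈ A) :
    ∑ k ∈ Finset.range A.card, w (k + 1) ≤ ∑ x ∈ A, w (reachSet O x).card := by
  classical
  induction A using Finset.induction_on_min_value f with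
  | empty => simp
  | insert m A hm hmin ih =>
    have hclosed : ∀ ⦃a b⦄, O a b → a ∈ A → b ∈ A := by
      intro a b hab ha
      refine (Finset.mem_insert.1 (hA hab (Finset.mem_insert_of_mem ha))).resolve_left ?_
      rintro rfl
      exact (hf a b hab).not_ge (hmin a ha)
    have hcard : (reachSet O m).card ≤ A.card + 1 :=
      (Finset.card_le_card (reachSet_subset hA (Finset.mem_insert_self m A))).trans
        (Finset.card_insert_le m A)
    rw [Finset.card_insert_of_notMem hm, Finset.sum_range_succ, Finset.sum_insert hm, add_comm]
    exact add_le_add (hw hcard) (ih hclosed)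

end ReachSet

namespace IsRootedOrientation

variable [Fintype V] {v x : V}

theorem root_notMem_reachSet (h : IsRootedOrientation G v S O) (hxv : x ≠ v) :
    v ∉ reachSet O x := by
  intro hv
  rcases (mem_reachSet.1 hv).cases_tail with hvx | ⟨z, -, hz⟩
  · exact hxv hvx.symm
  · exact h.not_arc_root z hz

theorem restrict_reachSet (h : IsRootedOrientation G v S O) (hx : x ∈ S) :
    IsRootedOrientation G x (reachSet O x) (restrictRel O (reachSet O x)) where
  toIsAcyclicOrientation :=
    h.restrict (reachSet_subset (fun _ _ hab _ => h.right_mem hab) hx)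
  root_mem := self_mem_reachSet O x
  exists_arc z hz hzx := by
    rcases (mem_reachSet.1 hz).cases_tail with hzx' | ⟨a, ha, haz⟩
    · exact absurd hzx' hzx
    · exact ⟨a, haz, mem_reachSet.2 ha, hz⟩

variable [DecidableEq V]

theorem restrict_sdiff_reachSet (h : IsRootedOrientation G v S O) (hxv : x ≠ v) :
    IsRootedOrientation G v (S \ reachSet O x) (restrictRel O (S \ reachSet O x)) where
  toIsAcyclicOrientation := h.restrict Finset.sdiff_subset
  root_mem := Finset.mem_sdiff.2 ⟨h.root_mem, h.root_notMem_reachSet hxv⟩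
  exists_arc z hz hzv := by
    obtain ⟨hzS, hzR⟩ := Finset.mem_sdiff.1 hz
    obtain ⟨a, ha⟩ := h.exists_arc z hzS hzv
    exact ⟨a, ha, Finset.mem_sdiff.2 ⟨h.left_mem ha, fun haR => hzR (mem_reachSet_of_arc ha haR)⟩,
      hz⟩

theorem sum_range_le (h : IsRootedOrientation G v S O) {w : ℕ → ℝ} (hw : Antitone w) :
    ∑ k ∈ Finset.range S.card, w k ≤ w 0 + ∑ x ∈ S.erase v, w (reachSet O x).card := by
  obtain ⟨f, hf⟩ := h.rank
  have hclosed : ∀ ⦃a b⦄, O a b → a ∈ S.erase v → b ∈ S.erase v := by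
    rintro a b hab -
    refine Finset.mem_erase.2 ⟨?_, h.right_mem hab⟩
    rintro rfl
    exact h.not_arc_root a hab
  rw [← Finset.card_erase_add_one h.root_mem, Finset.sum_range_succ', add_comm]
  exact add_le_add_right (sum_range_le_sum_reachSet hf hw _ hclosed) (w 0)

end IsRootedOrientation

section Counting

variable [Fintype V] [DecidableEq V]

open scoped Classical in
/-- The set of acyclic orientations of the subgraph of `G` induced by `S` whose only source is
`v`. -/
noncomputable def rootedOrientations (G : SimpleGraph V) (v : V) (S : Finset V) :
    Finset (V → V → Prop) :=
  {O | IsRootedOrientation G v S O}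

/-- The number of pairs of a vertex and an acyclic orientation of the subgraph of `G` induced by
`S` whose only source is that vertex. -/
noncomputable def numRooted (G : SimpleGraph V) (S : Finset V) : ℝ :=
  ∑ v, ((rootedOrientations G v S).card : ℝ)

theorem mem_rootedOrientations {v : V} :
    O ∈ rootedOrientations G v S ↔ IsRootedOrientation G v S O := by
  simp [rootedOrientations]

theorem rootedOrientations_eq_empty {v : V} (hv : v ∉ S) : rootedOrientations G v S = ∅ :=
  Finset.eq_empty_of_forall_notMem fun _ hO => hv (mem_rootedOrientations.1 hO).root_mem

theorem numRooted_nonneg (G : SimpleGraph V) (S : Finset V) : 0 ≤ numRooted G S :=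
  Finset.sum_nonneg fun _ _ => Nat.cast_nonneg _

theorem numRooted_singleton_pos (G : SimpleGraph V) (v : V) : 0 < numRooted G {v} := by
  have hbot : ⊥ ∈ rootedOrientations G v {v} := mem_rootedOrientations.2
    { toIsAcyclicOrientation := isAcyclicOrientation_bot.2 (by simp)
      root_mem := Finset.mem_singleton_self v
      exists_arc := fun x hx hxv => absurd (Finset.mem_singleton.1 hx) hxv }
  exact Finset.sum_pos' (fun _ _ => Nat.cast_nonneg _)
    ⟨v, Finset.mem_univ v, Nat.cast_pos.2 (Finset.card_pos.2 ⟨⊥, hbot⟩)⟩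

theorem numRooted_pair_of_not_adj {a b : V} (hab : a ≠ b) (hadj : ¬ G.Adj a b) :
    numRooted G {a, b} = 0 := by
  refine Finset.sum_eq_zero fun v _ => ?_
  rw [Nat.cast_eq_zero, Finset.card_eq_zero]
  refine Finset.eq_empty_of_forall_notMem fun O hO => ?_
  rw [mem_rootedOrientations] at hO
  obtain ⟨x, hx, hxv⟩ : ∃ x ∈ ({a, b} : Finset V), x ≠ v := by
    by_cases ha : a = v
    · exact ⟨b, by simp, fun hb => hab (ha.trans hb.symm)⟩
    · exact ⟨a, by simp, ha⟩
  obtain ⟨z, hz⟩ := hO.exists_arc x hx hxv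
  have hzx := hO.adj hz
  have hzmem := hO.left_mem hz
  simp only [Finset.mem_insert, Finset.mem_singleton] at hx hzmem
  rcases hx with rfl | rfl <;> rcases hzmem with rfl | rfl
  exacts [hzx.ne rfl, hadj hzx.symm, hadj hzx, hzx.ne rfl]

theorem card_filter_reachSet_eq_le {v x : V} (hx : x ∈ T.erase v) (R : Finset V) :
    ((rootedOrientations G v T).filter (reachSet · x = R)).card ≤
      (rootedOrientations G x R).card * (rootedOrientations G v (T \ R)).card := by
  rw [← Finset.card_product]
  obtain ⟨hxv, hxT⟩ := Finset.mem_erase.1 hx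
  refine Finset.card_le_card_of_injOn (fun O => (restrictRel O R, restrictRel O (T \ R))) ?_ ?_
  · intro O hO
    obtain ⟨hOv, rfl⟩ := Finset.mem_filter.1 hO
    rw [mem_rootedOrientations] at hOv
    exact Finset.mem_product.2 ⟨mem_rootedOrientations.2 (hOv.restrict_reachSet hxT),
      mem_rootedOrientations.2 (hOv.restrict_sdiff_reachSet hxv)⟩
  · intro O hO O' hO' heq
    obtain ⟨hOv, rfl⟩ := Finset.mem_filter.1 hO
    obtain ⟨hOv', hR⟩ := Finset.mem_filter.1 hO'
    obtain ⟨heqR, heq_sdiff⟩ := Prod.mk.inj heq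
    exact (mem_rootedOrientations.1 hOv).eq_of_restrictRel_eq
      (mem_rootedOrientations.1 hOv').toIsAcyclicOrientation
      (fun _ _ => mem_reachSet_of_arc) (hR ▸ fun _ _ => mem_reachSet_of_arc) heqR heq_sdiff

theorem sum_reachSet_le_setConv {v : V} {w : ℕ → ℝ} (hw : ∀ k, 0 ≤ w k) (T : Finset V) :
    ∑ O ∈ rootedOrientations G v T, ∑ x ∈ T.erase v, w (reachSet O x).card ≤
      setConv (fun R => ((rootedOrientations G v R).card : ℝ))
        (fun R => w R.card * numRooted G R) T := by
  have hmaps : ∀ x ∈ T.erase v, ∀ O ∈ rootedOrientations G v T, reachSet O x ∈ T.powerset :=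
    fun x hx O hO => Finset.mem_powerset.2 <| reachSet_subset
      (fun _ _ hab _ => (mem_rootedOrientations.1 hO).right_mem hab) (Finset.mem_of_mem_erase hx)
  have hfiber : ∀ x ∈ T.erase v, ∑ O ∈ rootedOrientations G v T, w (reachSet O x).card ≤
      ∑ R ∈ T.powerset, ((rootedOrientations G v (T \ R)).card : ℝ) *
        (w R.card * (rootedOrientations G x R).card) := by
    intro x hx
    rw [← Finset.sum_fiberwise_of_maps_to (hmaps x hx)]
    refine Finset.sum_le_sum fun R _ => ?_
    rw [Finset.sum_congr rfl fun _ hO => by rw [(Finset.mem_filter.1 hO).2], Finset.sum_const,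
      nsmul_eq_mul]
    calc _ ≤ ((rootedOrientations G x R).card * (rootedOrientations G v (T \ R)).card : ℝ) *
          w R.card := by
            gcongr
            · exact hw _
            · exact_mod_cast card_filter_reachSet_eq_le hx R
      _ = _ := by ring
  calc _ = ∑ x ∈ T.erase v, ∑ O ∈ rootedOrientations G v T, w (reachSet O x).card :=
        Finset.sum_comm
    _ ≤ ∑ x, ∑ R ∈ T.powerset, ((rootedOrientations G v (T \ R)).card : ℝ) *
        (w R.card * (rootedOrientations G x R).card) :=
        (Finset.sum_le_sum hfiber).trans <| Finset.sum_le_univ_sum_of_nonneg fun x =>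
          Finset.sum_nonneg fun R _ => mul_nonneg (Nat.cast_nonneg _)
            (mul_nonneg (hw _) (Nat.cast_nonneg _))
    _ = _ := by
        rw [setConv, sum_powerset_sdiff_swap (fun A B =>
          ((rootedOrientations G v A).card : ℝ) * (w B.card * numRooted G B)), Finset.sum_comm]
        simp only [numRooted, Finset.mul_sum]

theorem isReachWeight_numRooted (G : SimpleGraph V) : IsReachWeight (numRooted G) where
  nonneg := numRooted_nonneg G
  singleton_pos := numRooted_singleton_pos G
  reachGap_nonneg {w} hw hw0 T := by
    have hroot : ∀ v, ((rootedOrientations G v T).card : ℝ) * ∑ k ∈ Finset.range T.card, w k ≤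
        w 0 * (rootedOrientations G v T).card +
          setConv (fun R => ((rootedOrientations G v R).card : ℝ))
            (fun R => w R.card * numRooted G R) T := by
      intro v
      calc _ = ∑ _O ∈ rootedOrientations G v T, ∑ k ∈ Finset.range T.card, w k := by
            rw [Finset.sum_const, nsmul_eq_mul]
        _ ≤ ∑ O ∈ rootedOrientations G v T,
              (w 0 + ∑ x ∈ T.erase v, w (reachSet O x).card) :=
            Finset.sum_le_sum fun O hO => (mem_rootedOrientations.1 hO).sum_range_le hw
        _ ≤ _ := by
            rw [Finset.sum_add_distrib, Finset.sum_const, nsmul_eq_mul, mul_comm]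
            exact add_le_add_right (sum_reachSet_le_setConv hw0 T) _
    have hsum := Finset.sum_le_sum fun v (_ : v ∈ Finset.univ) => hroot v
    rw [Finset.sum_add_distrib, ← Finset.sum_mul, ← Finset.mul_sum, ← setConv_sum_left] at hsum
    exact sub_nonneg.2 hsum

end Counting

section IndependentSets

/-- The relation `O` on `T` together with all edges of `G` from `T` to `S \ T`, oriented towards
`S \ T`. -/
def extendRel [DecidableEq V] (G : SimpleGraph V) (S T : Finset V) (O : V → V → Prop) :
    V → V → Prop :=
  fun a b => O a b ∨ (a ∈ T ∧ b ∈ S \ T ∧ G.Adj a b)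

theorem IsAcyclicOrientation.extend [DecidableEq V] (h : IsAcyclicOrientation G T O) (hT : T ⊆ S)
    (hindep : G.IsIndepSet (S \ T : Finset V)) :
    IsAcyclicOrientation G S (extendRel G S T O) where
  adj hab := hab.elim h.adj fun hcross => hcross.2.2
  left_mem hab := hT (hab.elim h.left_mem And.left)
  right_mem hab :=
    hab.elim (fun harc => hT (h.right_mem harc)) fun hcross => (Finset.mem_sdiff.1 hcross.2.1).1
  total {a b} ha hb hab := by
    by_cases haT : a ∈ T <;> by_cases hbT : b ∈ T
    · exact (h.total haT hbT hab).imp Or.inl Or.inl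
    · exact Or.inl (Or.inr ⟨haT, Finset.mem_sdiff.2 ⟨hb, hbT⟩, hab⟩)
    · exact Or.inr (Or.inr ⟨hbT, Finset.mem_sdiff.2 ⟨ha, haT⟩, hab.symm⟩)
    · exact (hindep (Finset.mem_coe.2 (Finset.mem_sdiff.2 ⟨ha, haT⟩))
        (Finset.mem_coe.2 (Finset.mem_sdiff.2 ⟨hb, hbT⟩)) hab.ne hab).elim
  rank := by
    obtain ⟨f, hf⟩ := h.rank
    refine ⟨fun x => if x ∈ T then f x else T.sup f + 1, ?_⟩
    rintro a b (hab | ⟨ha, hb, -⟩)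
    · simpa [h.left_mem hab, h.right_mem hab] using hf a b hab
    · simpa [ha, (Finset.mem_sdiff.1 hb).2] using Nat.lt_succ_of_le (Finset.le_sup ha)

variable [Fintype V]

open scoped Classical in
/-- The set of acyclic orientations of the subgraph of `G` induced by `S`. -/
noncomputable def acyclicOrientations (G : SimpleGraph V) (S : Finset V) : Finset (V → V → Prop) :=
  {O | IsAcyclicOrientation G S O}

open scoped Classical in
/-- The set of vertices with an outgoing arc. -/
noncomputable def nonSinks (O : V → V → Prop) : Finset V := {x | ∃ z, O x z}

open scoped Classical in
/-- The set of vertices with an incoming arc. -/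
noncomputable def nonSources (O : V → V → Prop) : Finset V := {x | ∃ z, O z x}

theorem mem_acyclicOrientations :
    O ∈ acyclicOrientations G S ↔ IsAcyclicOrientation G S O := by
  simp [acyclicOrientations]

theorem mem_nonSinks {x : V} : x ∈ nonSinks O ↔ ∃ z, O x z := by simp [nonSinks]

theorem mem_nonSources {x : V} : x ∈ nonSources O ↔ ∃ z, O z x := by simp [nonSources]

theorem nonSinks_bot : nonSinks (⊥ : V → V → Prop) = ∅ :=
  Finset.eq_empty_of_forall_notMem fun _ hx => (mem_nonSinks.1 hx).elim fun _ => id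

theorem nonSources_bot : nonSources (⊥ : V → V → Prop) = ∅ :=
  Finset.eq_empty_of_forall_notMem fun _ hx => (mem_nonSources.1 hx).elim fun _ => id

theorem mem_Icc_insert_iff [DecidableEq V] {v : V} :
    T ∈ Finset.Icc (insert v (nonSinks O)) (insert v (nonSources O)) ↔
      v ∈ T ∧ nonSinks O ⊆ T ∧ ∀ x ∈ T, x ≠ v → ∃ z, O z x := by
  simp only [Finset.mem_Icc, Finset.insert_subset_iff, and_assoc]
  refine and_congr_right fun _ => and_congr_right fun _ => forall₂_congr fun x _ => ?_
  rw [Finset.mem_insert, mem_nonSources, or_iff_not_imp_left]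

namespace IsAcyclicOrientation

theorem isIndepSet_of_nonSinks_disjoint {A : Finset V} (h : IsAcyclicOrientation G S O)
    (hA : A ⊆ S) (hdisj : Disjoint A (nonSinks O)) : G.IsIndepSet (A : Set V) := by
  intro a ha b hb _ hab
  rcases h.total (hA ha) (hA hb) hab with harc | harc
  · exact Finset.disjoint_left.1 hdisj ha (mem_nonSinks.2 ⟨b, harc⟩)
  · exact Finset.disjoint_left.1 hdisj hb (mem_nonSinks.2 ⟨a, harc⟩)

variable [DecidableEq V] {v : V}

theorem insert_nonSinks_eq_insert_nonSources_iff (h : IsAcyclicOrientation G S O) :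
    insert v (nonSinks O) = insert v (nonSources O) ↔ O = ⊥ := by
  refine ⟨fun heq => ?_, ?_⟩
  · by_contra hne
    obtain ⟨f, hf⟩ := h.rank
    obtain ⟨a, b, hab⟩ : ∃ a b, O a b := by
      by_contra! hno
      exact hne (funext₂ fun a b => eq_false (hno a b))
    obtain ⟨s, hs, hmin⟩ := Finset.exists_min_image (nonSinks O) f ⟨a, mem_nonSinks.2 ⟨b, hab⟩⟩
    obtain ⟨t, ht, hmax⟩ := Finset.exists_max_image (nonSources O) f
      ⟨b, mem_nonSources.2 ⟨a, hab⟩⟩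
    have hs_source : s ∉ nonSources O := fun hs' => by
      obtain ⟨z, hz⟩ := mem_nonSources.1 hs'
      exact (hf z s hz).not_ge (hmin z (mem_nonSinks.2 ⟨s, hz⟩))
    have ht_sink : t ∉ nonSinks O := fun ht' => by
      obtain ⟨z, hz⟩ := mem_nonSinks.1 ht'
      exact (hf t z hz).not_ge (hmax z (mem_nonSources.2 ⟨t, hz⟩))
    have hsv : s = v := (Finset.mem_insert.1 (heq ▸ Finset.mem_insert_of_mem hs)).resolve_right
      hs_source
    have htv : t = v := (Finset.mem_insert.1 (heq ▸ Finset.mem_insert_of_mem ht)).resolve_right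
      ht_sink
    exact ht_sink (htv.trans hsv.symm ▸ hs)
  · rintro rfl
    rw [nonSinks_bot, nonSources_bot]

end IsAcyclicOrientation

variable [DecidableEq V] {v : V}

theorem card_rootedOrientations_of_isIndepSet (hT : T ⊆ S)
    (hindep : G.IsIndepSet (S \ T : Finset V)) :
    (rootedOrientations G v T).card = ((acyclicOrientations G S).filter fun O =>
      T ∈ Finset.Icc (insert v (nonSinks O)) (insert v (nonSources O))).card := by
  symm
  refine Finset.card_nbij (restrictRel · T) ?_ ?_ ?_
  · intro O hO
    simp only [Finset.coe_filter, Set.mem_ofPred_eq, mem_acyclicOrientations,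
      mem_Icc_insert_iff] at hO
    obtain ⟨hO, hv, hsinks, harc⟩ := hO
    refine mem_rootedOrientations.2 ⟨hO.restrict hT, hv, fun x hx hxv => ?_⟩
    obtain ⟨z, hz⟩ := harc x hx hxv
    exact ⟨z, hz, hsinks (mem_nonSinks.2 ⟨x, hz⟩), hx⟩
  · intro O hO O' hO' heq
    simp only [Finset.coe_filter, Set.mem_ofPred_eq, mem_acyclicOrientations,
      mem_Icc_insert_iff] at hO hO'
    have hno_arc : ∀ {P}, nonSinks P ⊆ T → ∀ ⦃a b⦄, P a b → a ∉ S \ T := fun hP a b hab ha =>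
      (Finset.mem_sdiff.1 ha).2 (hP (mem_nonSinks.2 ⟨b, hab⟩))
    have hbot : ∀ {P}, nonSinks P ⊆ T → restrictRel P (S \ T) = ⊥ := fun hP =>
      funext₂ fun a b => eq_false fun hab => hno_arc hP hab.1 hab.2.1
    refine hO.1.eq_of_restrictRel_eq (R := S \ T) hO'.1
      (fun a b hab ha => (hno_arc hO.2.2.1 hab ha).elim)
      (fun a b hab ha => (hno_arc hO'.2.2.1 hab ha).elim)
      ((hbot hO.2.2.1).trans (hbot hO'.2.2.1).symm) ?_
    rwa [Finset.sdiff_sdiff_eq_self hT]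
  · intro O hO
    obtain ⟨hO, hv, harc⟩ := mem_rootedOrientations.1 hO
    refine ⟨extendRel G S T O, ?_, ?_⟩
    · simp only [Finset.coe_filter, Set.mem_ofPred_eq, mem_acyclicOrientations, mem_Icc_insert_iff]
      refine ⟨hO.extend hT hindep, hv, fun x hx => ?_, fun x hx hxv =>
        (harc x hx hxv).imp fun z => Or.inl⟩
      obtain ⟨z, hz⟩ := mem_nonSinks.1 hx
      exact hz.elim hO.left_mem And.left
    · ext a b
      refine ⟨fun ⟨hab, _, hb⟩ => hab.resolve_right fun hcross => ?_, fun hab =>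
        ⟨Or.inl hab, hO.left_mem hab, hO.right_mem hab⟩⟩
      exact (Finset.mem_sdiff.1 hcross.2.1).2 hb

open scoped Classical in
/-- The indicator function of the independent sets, with sign `(-1) ^ #S`. -/
noncomputable def signedIndep (G : SimpleGraph V) (S : Finset V) : ℝ :=
  if G.IsIndepSet (S : Set V) then (-1) ^ S.card else 0

theorem card_rootedOrientations_mul_signedIndep (hT : T ⊆ S) :
    (rootedOrientations G v T).card * signedIndep G (S \ T) =
      (-1) ^ S.card * ∑ O ∈ acyclicOrientations G S,
        if T ∈ Finset.Icc (insert v (nonSinks O)) (insert v (nonSources O))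
          then (-1) ^ T.card else 0 := by
  rw [← Finset.sum_filter, Finset.sum_const, nsmul_eq_mul, signedIndep]
  split_ifs with hindep
  · rw [card_rootedOrientations_of_isIndepSet hT hindep,
      ← Finset.card_sdiff_add_card_eq_card hT, pow_add]
    have hsq : ((-1 : ℝ) ^ T.card) * (-1) ^ T.card = 1 := by rw [← mul_pow]; simp
    rw [mul_left_comm, mul_assoc, hsq, mul_one]
  · rw [mul_zero, Finset.filter_false_of_mem, Finset.card_empty, Nat.cast_zero, zero_mul, mul_zero]
    intro O hO hTO
    refine hindep ((mem_acyclicOrientations.1 hO).isIndepSet_of_nonSinks_disjoint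
      Finset.sdiff_subset (Finset.disjoint_left.2 fun x hx hxO => ?_))
    exact (Finset.mem_sdiff.1 hx).2 ((mem_Icc_insert_iff.1 hTO).2.1 hxO)

theorem setConv_rootedOrientations_signedIndep (hv : v ∈ S) :
    setConv (fun T => ((rootedOrientations G v T).card : ℝ)) (signedIndep G) S =
      -signedIndep G S := by
  classical
  have hinterval : ∀ O ∈ acyclicOrientations G S, (∑ T ∈ S.powerset,
      if T ∈ Finset.Icc (insert v (nonSinks O)) (insert v (nonSources O))
        then (-1 : ℝ) ^ T.card else 0) = if O = ⊥ then -1 else 0 := by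
    intro O hO
    rw [mem_acyclicOrientations] at hO
    have hIcc : S.powerset.filter
        (· ∈ Finset.Icc (insert v (nonSinks O)) (insert v (nonSources O))) =
          Finset.Icc (insert v (nonSinks O)) (insert v (nonSources O)) := by
      refine Finset.filter_mem_eq_inter.trans (Finset.inter_eq_right.2 fun T hT => ?_)
      refine Finset.mem_powerset.2 ((Finset.mem_Icc.1 hT).2.trans
        (Finset.insert_subset hv fun x hx => ?_))
      exact (mem_nonSources.1 hx).elim fun _ => hO.right_mem
    rw [← Finset.sum_filter, hIcc, sum_Icc_neg_one_pow_card]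
    simp only [hO.insert_nonSinks_eq_insert_nonSources_iff]
    split_ifs with hbot
    · rw [hbot, nonSinks_bot]
      simp
    · rfl
  calc _ = ∑ T ∈ S.powerset, (-1) ^ S.card * ∑ O ∈ acyclicOrientations G S,
        if T ∈ Finset.Icc (insert v (nonSinks O)) (insert v (nonSources O))
          then (-1) ^ T.card else 0 :=
        Finset.sum_congr rfl fun T hT =>
          card_rootedOrientations_mul_signedIndep (Finset.mem_powerset.1 hT)
    _ = (-1) ^ S.card * ∑ O ∈ acyclicOrientations G S, if O = ⊥ then -1 else 0 := by
        rw [← Finset.mul_sum, Finset.sum_comm, Finset.sum_congr rfl hinterval]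
    _ = -signedIndep G S := by
        simp [signedIndep, mem_acyclicOrientations, isAcyclicOrientation_bot, neg_ite]

theorem setConv_numRooted_signedIndep (G : SimpleGraph V) (S : Finset V) :
    setConv (numRooted G) (signedIndep G) S = -(S.card * signedIndep G S) := by
  have hroot : ∀ v, setConv (fun T => ((rootedOrientations G v T).card : ℝ)) (signedIndep G) S =
      if v ∈ S then -signedIndep G S else 0 := by
    intro v
    split_ifs with hv
    · exact setConv_rootedOrientations_signedIndep hv
    · refine Finset.sum_eq_zero fun T hT => ?_
      beta_reduce
      rw [rootedOrientations_eq_empty fun hvT => hv (Finset.mem_powerset.1 hT hvT),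
        Finset.card_empty, Nat.cast_zero, zero_mul]
  calc setConv (numRooted G) (signedIndep G) S = ∑ v, if v ∈ S then -signedIndep G S else 0 := by
        simp only [← hroot, ← setConv_sum_left]
        rfl
    _ = -(S.card * signedIndep G S) := by
        rw [← Finset.sum_filter, Finset.sum_const, nsmul_eq_mul]
        simp

end IndependentSets

end Orientations

section Colorings

variable {V α : Type*} {G : SimpleGraph V} {S B : Finset V}

/-- The number of proper colorings with `k` colors of the subgraph of `G` induced by `S`, with
sign `(-1) ^ #S`. -/
noncomputable def signedColorings (G : SimpleGraph V) (k : ℕ) (S : Finset V) : ℝ :=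
  (-1) ^ S.card * Nat.card ((G.induce (S : Set V)).Coloring (Fin k))

theorem signedColorings_zero (hS : S.Nonempty) : signedColorings G 0 S = 0 := by
  obtain ⟨v, hv⟩ := hS
  have : IsEmpty ((G.induce (S : Set V)).Coloring (Fin 0)) := ⟨fun c => (c ⟨v, hv⟩).elim0⟩
  rw [signedColorings, Nat.card_of_isEmpty, Nat.cast_zero, mul_zero]

theorem signedColorings_empty (k : ℕ) : signedColorings G k ∅ = 1 := by
  have : IsEmpty ((∅ : Finset V) : Set V) := by simp
  have : Unique ((G.induce ((∅ : Finset V) : Set V)).Coloring (Fin k)) :=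
    ⟨⟨.ofIsEmpty⟩, fun _ => RelHom.ext isEmptyElim⟩
  rw [signedColorings, Nat.card_unique, Finset.card_empty, pow_zero, Nat.cast_one, mul_one]

variable [DecidableEq V]

open scoped Classical in
/-- The set of vertices with the color `none`. -/
noncomputable def noneClass (c : (G.induce (S : Set V)).Coloring (Option α)) : Finset V :=
  {v ∈ S | ∃ hv : v ∈ S, c ⟨v, hv⟩ = none}

theorem mem_noneClass {c : (G.induce (S : Set V)).Coloring (Option α)} {v : V} (hv : v ∈ S) :
    v ∈ noneClass c ↔ c ⟨v, hv⟩ = none := by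
  simp [noneClass, hv]

theorem noneClass_subset (c : (G.induce (S : Set V)).Coloring (Option α)) : noneClass c ⊆ S :=
  Finset.filter_subset _ _

theorem isIndepSet_noneClass (c : (G.induce (S : Set V)).Coloring (Option α)) :
    G.IsIndepSet (noneClass c : Set V) := by
  intro a ha b hb _ hab
  have haS := noneClass_subset c ha
  have hbS := noneClass_subset c hb
  exact c.valid (v := ⟨a, haS⟩) (w := ⟨b, hbS⟩) hab
    (((mem_noneClass haS).1 ha).trans ((mem_noneClass hbS).1 hb).symm)

/-- The coloring that agrees with `d` outside the independent set `B` and takes the extra color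
`none` on `B`. -/
def extendColoring (hB : G.IsIndepSet (B : Set V))
    (d : (G.induce ((S \ B : Finset V) : Set V)).Coloring α) :
    (G.induce (S : Set V)).Coloring (Option α) :=
  SimpleGraph.Coloring.mk
    (fun v => if hv : (v : V) ∈ B then none else some (d ⟨v, Finset.mem_sdiff.2 ⟨v.2, hv⟩⟩)) <| by
    intro v w hvw
    have hadj : G.Adj v w := hvw
    by_cases hv : (v : V) ∈ B <;> by_cases hw : (w : V) ∈ B
    · exact absurd hadj (hB hv hw hadj.ne)
    · simp [hv, hw]
    · simp [hv, hw]
    · simp only [hv, hw, dite_false, ne_eq, Option.some_inj]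
      exact d.valid (v := ⟨v, Finset.mem_sdiff.2 ⟨v.2, hv⟩⟩)
        (w := ⟨w, Finset.mem_sdiff.2 ⟨w.2, hw⟩⟩) hvw

theorem extendColoring_apply (hB : G.IsIndepSet (B : Set V))
    (d : (G.induce ((S \ B : Finset V) : Set V)).Coloring α) (v : (S : Set V)) :
    extendColoring hB d v =
      if hv : (v : V) ∈ B then none else some (d ⟨v, Finset.mem_sdiff.2 ⟨v.2, hv⟩⟩) :=
  rfl

theorem noneClass_extendColoring (hB : G.IsIndepSet (B : Set V)) (hBS : B ⊆ S)
    (d : (G.induce ((S \ B : Finset V) : Set V)).Coloring α) :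
    noneClass (extendColoring hB d) = B := by
  refine Finset.ext fun v => ⟨fun hv => ?_, fun hv => ?_⟩
  · rw [mem_noneClass (noneClass_subset _ hv), extendColoring_apply] at hv
    by_contra hvB
    simp [hvB] at hv
  · rw [mem_noneClass (hBS hv), extendColoring_apply, dif_pos hv]

theorem extendColoring_injective (hB : G.IsIndepSet (B : Set V)) :
    Function.Injective (extendColoring (S := S) (α := α) hB) := by
  intro d d' hdd'
  refine RelHom.ext fun (v : ((S \ B : Finset V) : Set V)) => ?_
  obtain ⟨hvS, hvB⟩ := Finset.mem_sdiff.1 v.2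
  have heq := congrArg (fun c : (G.induce (S : Set V)).Coloring (Option α) => c ⟨v, hvS⟩) hdd'
  simpa only [extendColoring_apply, hvB, dite_false, Option.some_inj] using heq

theorem exists_extendColoring_eq (c : (G.induce (S : Set V)).Coloring (Option α)) :
    ∃ d, extendColoring (isIndepSet_noneClass c) d = c := by
  have hsome : ∀ v : ((S \ noneClass c : Finset V) : Set V),
      ∃ x, c ⟨v, (Finset.mem_sdiff.1 v.2).1⟩ = some x := fun v =>
    Option.ne_none_iff_exists'.1 fun hnone =>
      (Finset.mem_sdiff.1 v.2).2 ((mem_noneClass (Finset.mem_sdiff.1 v.2).1).2 hnone)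
  choose d hd using hsome
  refine ⟨SimpleGraph.Coloring.mk d fun {v w} hvw heq => ?_, RelHom.ext fun v => ?_⟩
  · exact c.valid (v := ⟨v, (Finset.mem_sdiff.1 v.2).1⟩) (w := ⟨w, (Finset.mem_sdiff.1 w.2).1⟩) hvw
      ((hd v).trans ((congrArg some heq).trans (hd w).symm))
  · rw [extendColoring_apply]
    split_ifs with hv
    · exact ((mem_noneClass v.2).1 hv).symm
    · exact (hd ⟨v, Finset.mem_sdiff.2 ⟨v.2, hv⟩⟩).symm

open scoped Classical in
theorem card_coloring_option [Finite α] (G : SimpleGraph V) (S : Finset V) :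
    Nat.card ((G.induce (S : Set V)).Coloring (Option α)) =
      ∑ B ∈ S.powerset.filter fun B : Finset V => G.IsIndepSet (B : Set V),
        Nat.card ((G.induce ((S \ B : Finset V) : Set V)).Coloring α) := by
  have : Fintype ((G.induce (S : Set V)).Coloring (Option α)) := Fintype.ofFinite _
  rw [Nat.card_eq_fintype_card, ← Finset.card_univ,
    Finset.card_eq_sum_card_fiberwise (f := noneClass)
      (t := S.powerset.filter fun B : Finset V => G.IsIndepSet (B : Set V))]
  · refine Finset.sum_congr rfl fun B hB => ?_
    rw [Finset.mem_filter, Finset.mem_powerset] at hB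
    obtain ⟨hBS, hB⟩ := hB
    rw [← Fintype.card_subtype, ← Nat.card_eq_fintype_card]
    refine (Nat.card_congr (Equiv.ofBijective
      (fun d => ⟨extendColoring hB d, noneClass_extendColoring hB hBS d⟩) ⟨?_, ?_⟩)).symm
    · exact fun d d' hdd' => extendColoring_injective hB (congrArg Subtype.val hdd')
    · rintro ⟨c, rfl⟩
      exact (exists_extendColoring_eq c).imp fun d => Subtype.ext
  · exact fun c _ => Finset.mem_coe.2 (Finset.mem_filter.2
      ⟨Finset.mem_powerset.2 (noneClass_subset c), isIndepSet_noneClass c⟩)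

theorem signedColorings_succ (G : SimpleGraph V) (k : ℕ) :
    signedColorings G (k + 1) = setConv (signedIndep G) (signedColorings G k) := by
  classical
  funext S
  rw [signedColorings, Nat.card_congr (SimpleGraph.coloringCongr .refl (finSuccEquiv k)),
    card_coloring_option, Nat.cast_sum, Finset.sum_filter, Finset.mul_sum, setConv]
  refine Finset.sum_congr rfl fun B hB => ?_
  rw [signedIndep, signedColorings,
    ← Finset.card_sdiff_add_card_eq_card (Finset.mem_powerset.1 hB), pow_add]
  split_ifs <;> ring

theorem card_mul_signedColorings [Fintype V] (G : SimpleGraph V) (k : ℕ) (S : Finset V) :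
    S.card * signedColorings G k S = -k * setConv (numRooted G) (signedColorings G k) S := by
  induction k generalizing S with
  | zero =>
    rcases S.eq_empty_or_nonempty with rfl | hS
    · simp
    · simp [signedColorings_zero hS]
  | succ k ih =>
    have hindep : (fun T => T.card * signedIndep G T) =
        fun T => -1 * setConv (numRooted G) (signedIndep G) T := by
      funext T
      rw [setConv_numRooted_signedIndep]
      ring
    have hleft : setConv (fun T => T.card * signedIndep G T) (signedColorings G k) S =
        -setConv (numRooted G) (signedColorings G (k + 1)) S := by
      rw [hindep, setConv_const_mul_left, setConv_assoc, ← signedColorings_succ, neg_one_mul]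
    have hright : setConv (signedIndep G) (fun T => T.card * signedColorings G k T) S =
        -k * setConv (numRooted G) (signedColorings G (k + 1)) S := by
      rw [funext ih, setConv_const_mul_right, setConv_left_comm, ← signedColorings_succ]
    rw [signedColorings_succ, card_mul_setConv, ← signedColorings_succ, hleft, hright]
    push_cast
    ring

end Colorings

section Polynomials

variable {V : Type*}

/-- The polynomial `(-1) ^ #S * P(G[S], -x)`, whose coefficients are the absolute values of those
of the chromatic polynomial of the subgraph of `G` induced by `S`. -/
noncomputable def unsignedPoly (G : SimpleGraph V) (S : Finset V) : ℝ[X] :=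
  C ((-1) ^ S.card) * (chromaticPoly (G.induce (S : Set V))).comp (-X)

theorem unsignedPoly_eval_neg (G : SimpleGraph V) {k : ℕ} (hk : 0 < k) (S : Finset V) :
    (unsignedPoly G S).eval (-k : ℝ) = signedColorings G k S := by
  rw [unsignedPoly, signedColorings, eval_mul, eval_C, eval_comp, eval_neg, eval_X, neg_neg,
    chromaticPoly_eval _ k hk]

theorem eq_of_eval_neg_natCast_eq {p q : ℝ[X]}
    (h : ∀ k : ℕ, 0 < k → p.eval (-k : ℝ) = q.eval (-k : ℝ)) : p = q := by
  refine Polynomial.eq_of_infinite_eval_eq p q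
    (Set.infinite_of_injective_forall_mem (f := fun k : ℕ => -((k + 1 : ℕ) : ℝ)) ?_ ?_)
  · exact neg_injective.comp (Nat.cast_injective.comp (add_left_injective 1))
  · exact fun k => h (k + 1) k.succ_pos

theorem isSetExp_unsignedPoly [Fintype V] [DecidableEq V] (G : SimpleGraph V) :
    IsSetExp (numRooted G) (unsignedPoly G) where
  apply_empty := eq_of_eval_neg_natCast_eq fun k hk => by
    rw [unsignedPoly_eval_neg G hk, signedColorings_empty, eval_one]
  card_mul S := eq_of_eval_neg_natCast_eq fun k hk => by
    rw [eval_mul, eval_natCast, unsignedPoly_eval_neg G hk, card_mul_signedColorings, eval_mul,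
      eval_X, setConv, setConv, eval_finsetSum]
    simp only [eval_mul, eval_C, unsignedPoly_eval_neg G hk]

theorem unsignedPoly_univ [Fintype V] (G : SimpleGraph V) :
    unsignedPoly G Finset.univ = C ((-1) ^ Nat.card V) * (chromaticPoly G).comp (-X) := by
  refine eq_of_eval_neg_natCast_eq fun k hk => ?_
  rw [unsignedPoly_eval_neg G hk, signedColorings, Finset.coe_univ, Finset.card_univ,
    Nat.card_congr (SimpleGraph.coloringCongr G.induceUnivIso (.refl _)), eval_mul, eval_C,
    eval_comp, eval_neg, eval_X, neg_neg, chromaticPoly_eval G k hk, ← Nat.card_eq_fintype_card]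

theorem unsignedPoly_univ_coeff [Fintype V] (G : SimpleGraph V) {i : ℕ} (hi : i ≤ Nat.card V) :
    (unsignedPoly G Finset.univ).coeff i = chromaticCoeff G i := by
  obtain ⟨j, hj⟩ := Nat.exists_eq_add_of_le hi
  have hsq : ((-1 : ℝ) ^ i) * (-1) ^ i = 1 := by rw [← mul_pow]; simp
  rw [unsignedPoly_univ, ← neg_one_mul (X : ℝ[X]), ← C_1, ← C_neg, coeff_C_mul, comp_C_mul_X_coeff,
    chromaticCoeff, hj, Nat.add_sub_cancel_left, pow_add]
  linear_combination (-1) ^ j * (chromaticPoly G).coeff i * hsq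

theorem chromaticEps_eq [Fintype V] (G : SimpleGraph V) (x : ℝ) :
    chromaticEps G x = -((derivative (unsignedPoly G Finset.univ)).eval (-x) /
      (unsignedPoly G Finset.univ).eval (-x)) := by
  have hsign : ((-1 : ℝ) ^ Nat.card V) ≠ 0 := pow_ne_zero _ (by norm_num)
  rw [unsignedPoly_univ, derivative_C_mul, derivative_comp]
  simp only [derivative_neg, derivative_X, eval_mul, eval_C, eval_comp, eval_neg, eval_X, neg_neg,
    neg_mul, one_mul, mul_neg, neg_div, mul_div_mul_left _ _ hsign, chromaticEps]

theorem unsignedPoly_eval_pos [Finite V] (G : SimpleGraph V) {y : ℝ} (hy : 0 < y) (S : Finset V) :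
    0 < (unsignedPoly G S).eval y := by
  classical
  have := Fintype.ofFinite V
  exact (isSetExp_unsignedPoly G).eval_pos (numRooted_nonneg G) (numRooted_singleton_pos G) hy S

theorem sum_Icc_mul_chromaticCoeff [Fintype V] [Nonempty V] (G : SimpleGraph V) (f : ℕ → ℝ) :
    ∑ i ∈ Finset.Icc 1 (Nat.card V), f i * chromaticCoeff G i =
      (unsignedPoly G Finset.univ).sum fun i a => f i * a := by
  classical
  have hexp := isSetExp_unsignedPoly G
  have hdeg : (unsignedPoly G Finset.univ).natDegree < Nat.card V + 1 := by
    rw [Nat.lt_succ_iff, Nat.card_eq_fintype_card]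
    exact hexp.natDegree_le Finset.univ
  rw [sum_over_range' _ (fun i => mul_zero (f i)) _ hdeg, Finset.sum_range_succ',
    hexp.coeff_zero Finset.univ_nonempty, mul_zero, add_zero, Finset.range_eq_Ico,
    Finset.sum_Ico_add' (fun i => f i * (unsignedPoly G Finset.univ).coeff i) 0 _ 1]
  exact Finset.sum_congr rfl fun i hi => by
    rw [unsignedPoly_univ_coeff G (Finset.mem_Icc.1 hi).2]

end Polynomials

section Epsilon

variable {V : Type*} [Finite V]

theorem meanSize_eq [Nonempty V] (G : SimpleGraph V) :
    meanSize G = Nat.card V + chromaticEps G (-1) := by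
  have := Fintype.ofFinite V
  set p := unsignedPoly G Finset.univ with hp
  have hsum : ∑ i ∈ Finset.Icc 1 (Nat.card V), chromaticCoeff G i = p.eval 1 := by
    simpa [eval_eq_sum] using sum_Icc_mul_chromaticCoeff G 1
  have hsum_mul : ∑ i ∈ Finset.Icc 1 (Nat.card V), i * chromaticCoeff G i =
      (derivative p).eval 1 := by
    simpa [derivative_eval, mul_comm] using sum_Icc_mul_chromaticCoeff G Nat.cast
  have hpos : 0 < p.eval 1 := unsignedPoly_eval_pos G one_pos _
  rw [meanSize, chromaticEps_eq, neg_neg, ← hp]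
  simp only [sub_mul, Finset.sum_sub_distrib, ← Finset.mul_sum, hsum, hsum_mul]
  field_simp
  ring

theorem chromaticEps_lt_of_ne_top {G : SimpleGraph V} (hG : G ≠ ⊤) {x : ℝ} (hx : x < 0) :
    chromaticEps G x < -harmonicShift (-x) (Nat.card V) := by
  classical
  have := Fintype.ofFinite V
  obtain ⟨a, b, hab, hadj⟩ := SimpleGraph.ne_top_iff_exists_not_adj.1 hG
  have hlt := (isSetExp_unsignedPoly G).harmonicShift_mul_eval_lt (isReachWeight_numRooted G)
    (neg_pos.2 hx) (Finset.mem_univ a) (Finset.mem_univ b) hab (numRooted_pair_of_not_adj hab hadj)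
  rw [chromaticEps_eq, neg_lt_neg_iff, lt_div_iff₀ (unsignedPoly_eval_pos G (neg_pos.2 hx) _)]
  rwa [Finset.card_univ, ← Nat.card_eq_fintype_card] at hlt

theorem chromaticPoly_top : chromaticPoly (⊤ : SimpleGraph V) = descPochhammer ℝ (Nat.card V) := by
  refine (chromaticPoly_unique _ _ fun k _ => ?_).symm
  have := Fintype.ofFinite V
  have hcolorings : (⊤ : SimpleGraph V).Coloring (Fin k) ≃ (V ↪ Fin k) :=
    { toFun := fun c => ⟨c, fun a b h => by_contra fun hab => c.valid hab h⟩
      invFun := fun f => SimpleGraph.Coloring.mk f fun hab => f.injective.ne hab.ne }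
  rw [descPochhammer_eval_eq_descFactorial, Nat.card_congr hcolorings, Nat.card_eq_fintype_card,
    Nat.card_eq_fintype_card, Fintype.card_embedding_eq, Fintype.card_fin]

theorem derivative_descPochhammer_eval {x : ℝ} (hx : x < 0) (n : ℕ) :
    (derivative (descPochhammer ℝ n)).eval x =
      -harmonicShift (-x) n * (descPochhammer ℝ n).eval x := by
  induction n with
  | zero => simp [harmonicShift]
  | succ n ih =>
    have hxn : -x + n ≠ 0 := by
      have : (0 : ℝ) ≤ n := Nat.cast_nonneg n
      linarith
    rw [harmonicShift, Finset.sum_range_succ, ← harmonicShift, descPochhammer_succ_right]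
    simp only [derivative_mul, derivative_sub, derivative_X, derivative_natCast, sub_zero, mul_one,
      eval_add, eval_mul, eval_sub, eval_X, eval_natCast, ih]
    field_simp
    ring

theorem chromaticEps_top {x : ℝ} (hx : x < 0) :
    chromaticEps (⊤ : SimpleGraph V) x = -harmonicShift (-x) (Nat.card V) := by
  have hne : (descPochhammer ℝ (Nat.card V)).eval x ≠ 0 := by
    rw [descPochhammer_eval_eq_prod_range]
    refine Finset.prod_ne_zero_iff.2 fun j _ => ?_
    have : (0 : ℝ) ≤ j := Nat.cast_nonneg j
    linarith
  rw [chromaticEps, chromaticPoly_top, derivative_descPochhammer_eval hx,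
    mul_div_cancel_right₀ _ hne]

end Epsilon

end ChromaticPoly

theorem mainTheorem1 {V : Type*} [Finite V] (G : SimpleGraph V) (n : ℕ) (hn : Nat.card V = n)
    (hG : G ≠ ⊤) :
    (∀ x : ℝ, x < 0 → chromaticEps G x < chromaticEps (⊤ : SimpleGraph (Fin n)) x) ∧
      meanSize G < meanSize (⊤ : SimpleGraph (Fin n)) := by
  have hcard : Nat.card (Fin n) = Nat.card V := by rw [Nat.card_fin, hn]
  have heps : ∀ x : ℝ, x < 0 →
      chromaticEps G x < chromaticEps (⊤ : SimpleGraph (Fin n)) x := by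
    intro x hx
    rw [ChromaticPoly.chromaticEps_top hx, hcard]
    exact ChromaticPoly.chromaticEps_lt_of_ne_top hG hx
  refine ⟨heps, ?_⟩
  obtain ⟨v, -⟩ := SimpleGraph.ne_top_iff_exists_not_adj.1 hG
  have : Nonempty V := ⟨v⟩
  have : Nonempty (Fin n) := (Finite.card_pos_iff).1 (hcard ▸ Nat.card_pos)
  rw [ChromaticPoly.meanSize_eq, ChromaticPoly.meanSize_eq, hcard]
  exact add_lt_add_right (heps (-1) neg_one_lt_zero) _
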